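/- Consider the following finite zero-sum stochastic game with stages $t=1,\dots,T$. The state evolves as $X_{t+1}=f_t(X_t,U^1_t,U^2_t,W^s_t)$. Player 2 observes $Y_1=h_1(X_1,W_1)$ and $Y_{t}=h_{t}(X_{t},U^1_{t-1},U^2_{t-1},W_{t})$ for $t\ge 2$. All sets are finite (and the action sets non-empty), and $X_1$, all $W^s_t$ and all $W_t$ are independent. Player 2 knows $C_t=(Y_{1:t},U^2_{1:t-1})$ at stage $t$ (the common information), and player 1 knows $(X_{1:t},Y_{1:t},U^1_{1:t-1},U^2_{1:t-1})$. Both use behavioral strategies. Player 1 minimizes and player 2 maximizes $J=\mathbb E\big[\sum_{t=1}^T c_t(X_t,U^1_t,U^2_t)\big]$. Call this game $G$. Let $H$ be the game in which player 1 uses only $(X_t,C_t)$ at stage $t$, i.e. strategies $g^1_t(x_t,c_t)$. In the virtual game $H_v$, at stage $t$ the virtual players select from $C_t$ prescriptions $\gamma^1_t:\mathcal X_t\to\Delta\mathcal U^1_t$ and $\gamma^2_t\in\Delta\mathcal U^2_t$, i.e. they use strategies $\gamma^i_t=\chi^i_t(c_t)$; then $U^1_t\sim\gamma^1_t(X_t)$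 and $U^2_t\sim\gamma^2_t$, with the same dynamics and cost. In the expanded game the strategies are $\gamma^i_t=\tilde\chi^i_t(c_t,\gamma^{1:2}_{1:t-1})$. For a profile of the expanded game, $\varrho^1(\tilde\chi^1,\tilde\chi^2)$ is the strategy $\chi^1$ with $\chi^1_t(c_t)=\tilde\chi^1_t(c_t,\tilde\gamma^{1:2}_{1:t-1})$, where $\tilde\gamma^j_s=\tilde\chi^j_s(c_s,\tilde\gamma^{1:2}_{1:s-1})$ for $s<t$, $j=1,2$. For $\pi\in\Delta\mathcal X_t$, $\gamma^1:\mathcal X_t\to\Delta\mathcal U^1_t$ and $z=(u^2,y)$ put $Q_t(\pi,\gamma^1,z;x')=\sum_{x,u^1}\pi(x)\gamma^1(x;u^1)\,\mathbb P[X_{t+1}=x',Y_{t+1}=y\mid x,u^1,u^2]$ and $R_t(\pi,\gamma^1,z)=\sum_{x'}Q_t(\pi,\gamma^1,z;x')$. Let $F_t(\pi,\gamma^1,z)=Q_t(\pi,\gamma^1,z;\cdot)/R_t(\pi,\gamma^1,z)$ if $R_t(\pi,\gamma^1,z)>0$, and an arbitrary fixed value in $\Delta\mathcal X_{t+1}$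 depending on $(\pi,\gamma^1,z)$ otherwise. The belief $\pi_t$ associated with $(c_t,\gamma^{1:2}_{1:t-1})$ is given by $\pi_{s+1}=F_s(\pi_s,\gamma^1_s,z_{s+1})$ with $z_{s+1}=(u^2_s,y_{s+1})$, where $\pi_1$ is the conditional law of $X_1$ given $Y_1=y_1$ (arbitrary if $\mathbb P[Y_1=y_1]=0$). Let $V^u_{T+1}=V^l_{T+1}=0$ and, for $t\le T$, $$w^{u}_t(\pi,\gamma^1,\gamma^2)=\sum_{x,u^1,u^2}c_t(x,u^1,u^2)\pi(x)\gamma^1(x;u^1)\gamma^2(u^2)+\sum_{z=(u^2,y)}\gamma^2(u^2)R_t(\pi,\gamma^1,z)V^{u}_{t+1}(F_t(\pi,\gamma^1,z)),$$ let $w^l_t$ be defined in the same way with $V^l_{t+1}$, and let $V^u_t(\pi)=\inf_{\gamma^1}\sup_{\gamma^2}w^u_t$ and $V^l_t(\pi)=\sup_{\gamma^2}\inf_{\gamma^1}w^l_t$. A solution of the min-max program is a family of maps $\psi_t$ with $V^u_t(\pi)=\max_{\gamma^2}w^u_t(\pi,\psi_t(\pi),\gamma^2)$ for all $t\le T$ and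 all $\pi$; a solution of the max-min program is a family of maps $\varphi_t$ with $V^l_t(\pi)=\min_{\gamma^1}w^l_t(\pi,\gamma^1,\varphi_t(\pi))$ for all $t\le T$ and all $\pi$. Theorem. Both programs have solutions. For every pair of solutions $(\psi,\varphi)$ let $\tilde\chi^{1*}_t(c_t,\gamma^{1:2}_{1:t-1})=\psi_t(\pi_t)$ and $\tilde\chi^{2*}_t(c_t,\gamma^{1:2}_{1:t-1})=\varphi_t(\pi_t)$, let $\chi^{1*}=\varrho^1(\tilde\chi^{1*},\tilde\chi^{2*})$ and $g^{1*}_t(x_t,c_t)=[\chi^{1*}_t(c_t)](x_t)$. Then $\chi^{1*}$ is a minimax strategy of player 1 in $H_v$, and $g^{1*}$ is a minimax strategy of player 1 both in $H$ and in $G$; in each of these games, this strategy is also player 1's part of some Nash equilibrium. Moreover, $g^{1*}$ is based on the common information belief: against every strategy $g^2$ of player 2, for every $t\le T$ and every $c_t$ of positive probability under $(g^{1*},g^2)$, $g^{1*}_t(x_t,c_t)=[\psi_t(\Pi_t)](x_t)$ for all $x_t$, where $\Pi_t$ is the conditional law of $X_t$ given $C_t=c_t$ under $(g^{1*},g^2)$.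 -/

import Mathlib

universe u

noncomputable section

/-! ## Two-player zero-sum games: values, minimax strategies, Nash equilibria

Player 1 (first argument) minimizes and player 2 (second argument) maximizes the cost `J`. -/

section ZeroSum

variable {A B : Type*}

/-- The upper value `inf_a sup_b J(a, b)`. -/
def upperValue (J : A → B → ℝ) : ℝ := ⨅ a, ⨆ b, J a b

/-- `a` is a minimax strategy of player 1: it attains the infimum in the upper value. -/
def IsMinimaxStrategy (J : A → B → ℝ) (a : A) : Prop :=
  (⨆ b, J a b) = upperValue J

/-- `(a, b)` is a Nash equilibrium. -/
def IsNashEquilibrium (J : A → B → ℝ) (a : A) (b : B) : Prop :=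
  (∀ b', J a b' ≤ J a b) ∧ (∀ a', J a b ≤ J a' b)

/-- `a` is an equilibrium strategy of player 1. -/
def IsEquilibriumStrategy (J : A → B → ℝ) (a : A) : Prop :=
  ∃ b, IsNashEquilibrium J a b

end ZeroSum

/-- Probability distributions on a finite set, as vectors in the probability simplex. -/
abbrev FinDist (α : Type u) [Fintype α] : Type u := stdSimplex ℝ α

/-- The data of a game over `T` stages, in which the stages are numbered `0, …, T - 1`.
The primitive random variables are the initial state, the system noises `Ws t` and the
observation noises `Wo t`; they are independent, with the laws given here. There are no actions
before stage `0`, so the first observation is a function of the initial state and its noise.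
The data for stages from `T` on play no role. -/
structure GameModel where
  /-- the number of stages -/
  T : ℕ
  /-- the states -/
  X : ℕ → Type u
  /-- the actions of player 1 -/
  U1 : ℕ → Type u
  /-- the actions of player 2 -/
  U2 : ℕ → Type u
  /-- the observations of player 2 -/
  Y : ℕ → Type u
  /-- the values of the system noise -/
  Ws : ℕ → Type u
  /-- the values of the observation noise -/
  Wo : ℕ → Type u
  [fintypeX : ∀ t, Fintype (X t)]
  [fintypeU1 : ∀ t, Fintype (U1 t)]
  [fintypeU2 : ∀ t, Fintype (U2 t)]
  [fintypeY : ∀ t, Fintype (Y t)]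
  [fintypeWs : ∀ t, Fintype (Ws t)]
  [fintypeWo : ∀ t, Fintype (Wo t)]
  [nonemptyU1 : ∀ t, Nonempty (U1 t)]
  [nonemptyU2 : ∀ t, Nonempty (U2 t)]
  /-- the law of the initial state -/
  initLaw : FinDist (X 0)
  /-- the law of the system noise -/
  wsLaw : ∀ t, FinDist (Ws t)
  /-- the law of the observation noise -/
  woLaw : ∀ t, FinDist (Wo t)
  /-- the state dynamics -/
  f : ∀ t, X t → U1 t → U2 t → Ws t → X (t + 1)
  /-- the first observation of player 2 -/
  obsInit : X 0 → Wo 0 → Y 0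
  /-- the later observations of player 2 -/
  obs : ∀ t, X (t + 1) → U1 t → U2 t → Wo (t + 1) → Y (t + 1)
  /-- the stage costs -/
  cost : ∀ t, X t → U1 t → U2 t → ℝ

namespace GameModel

attribute [instance] fintypeX fintypeU1 fintypeU2 fintypeY fintypeWs fintypeWo
  nonemptyU1 nonemptyU2

variable (M : GameModel.{u})

/-! ### Histories and probabilities -/

/-- Complete histories `(x_{0:t}, y_{0:t}, u¹_{0:t-1}, u²_{0:t-1})`. -/
def Hist : ℕ → Type u
  | 0 => M.X 0 × M.Y 0
  | t + 1 => Hist t × (M.U1 t × M.U2 t × M.X (t + 1) × M.Y (t + 1))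

/-- The information `(y_{0:t}, u²_{0:t-1})` of player 2, which is also the common information. -/
def Common : ℕ → Type u
  | 0 => M.Y 0
  | t + 1 => Common t × (M.U2 t × M.Y (t + 1))

instance fintypeHist : ∀ t, Fintype (M.Hist t)
  | 0 => inferInstanceAs (Fintype (M.X 0 × M.Y 0))
  | t + 1 =>
    letI := fintypeHist t
    inferInstanceAs (Fintype (M.Hist t × (M.U1 t × M.U2 t × M.X (t + 1) × M.Y (t + 1))))

/-- The current state. -/
def state : ∀ {t : ℕ}, M.Hist t → M.X t
  | 0, h => h.1
  | _ + 1, h => h.2.2.2.1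

/-- The common information contained in a complete history. -/
def common : ∀ {t : ℕ}, M.Hist t → M.Common t
  | 0, h => h.2
  | _ + 1, h => (common h.1, h.2.2.1, h.2.2.2.2)

open Classical in
/-- `ℙ[X₀ = x, Y₀ = y]`. -/
def initProb (x : M.X 0) (y : M.Y 0) : ℝ :=
  M.initLaw x * ∑ w, if M.obsInit x w = y then M.woLaw 0 w else 0

open Classical in
/-- `ℙ[X_{t+1} = x', Y_{t+1} = y | X_t = x, U¹_t = u₁, U²_t = u₂]`. -/
def transProb (t : ℕ) (x : M.X t) (u₁ : M.U1 t) (u₂ : M.U2 t)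
    (x' : M.X (t + 1)) (y : M.Y (t + 1)) : ℝ :=
  (∑ w, if M.f t x u₁ u₂ w = x' then M.wsLaw t w else 0) *
    ∑ w, if M.obs t x' u₁ u₂ w = y then M.woLaw (t + 1) w else 0

/-- The law of the complete history when, given the history `h` at stage `t`, the actions are
drawn independently from `b₁ t h` and `b₂ t h`. -/
def pathLaw (b₁ : ∀ t, M.Hist t → FinDist (M.U1 t)) (b₂ : ∀ t, M.Hist t → FinDist (M.U2 t)) :
    ∀ t, M.Hist t → ℝ
  | 0, h => M.initProb h.1 h.2
  | t + 1, (h, u₁, u₂, x', y) =>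
    pathLaw b₁ b₂ t h * b₁ t h u₁ * b₂ t h u₂ * M.transProb t (M.state h) u₁ u₂ x' y

/-- The total cost of the stages before `t` along a history. -/
def totalCost : ∀ t, M.Hist t → ℝ
  | 0, _ => 0
  | t + 1, (h, u₁, u₂, _, _) => totalCost t h + M.cost t (M.state h) u₁ u₂

/-- The expected total cost of all `T` stages. -/
def expectedCost (b₁ : ∀ t, M.Hist t → FinDist (M.U1 t)) (b₂ : ∀ t, M.Hist t → FinDist (M.U2 t)) : ℝ :=
  ∑ h : M.Hist M.T, M.pathLaw b₁ b₂ M.T h * M.totalCost M.T h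

/-! ### The game of complete information on one side, and the game with reduced information -/

/-- Behavioral strategies of player 1 who knows the complete history. -/
abbrev Strategy1 : Type u := ∀ t, M.Hist t → FinDist (M.U1 t)

/-- Behavioral strategies of player 1 who uses only the current state (his private information)
and the common information. -/
abbrev ReducedStrategy1 : Type u := ∀ t, M.X t → M.Common t → FinDist (M.U1 t)

/-- Behavioral strategies of player 2. -/
abbrev Strategy2 : Type u := ∀ t, M.Common t → FinDist (M.U2 t)

/-- A reduced strategy, used by a player 1 who knows the complete history. -/
def ReducedStrategy1.toStrategy1 {M : GameModel.{u}} (g : M.ReducedStrategy1) : M.Strategy1 :=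
  fun t h => g t (M.state h) (M.common h)

/-- The cost of the original game, in which player 1 has complete information. -/
def J (g₁ : M.Strategy1) (g₂ : M.Strategy2) : ℝ :=
  M.expectedCost g₁ (fun t h => g₂ t (M.common h))

/-- The cost of the game in which player 1's information is reduced. -/
def reducedJ (g₁ : M.ReducedStrategy1) (g₂ : M.Strategy2) : ℝ :=
  M.expectedCost (fun t h => g₁ t (M.state h) (M.common h)) (fun t h => g₂ t (M.common h))

/-! ### The virtual game -/

/-- Prescriptions of virtual player 1: maps from the private information, which is the current
state, to distributions over actions. -/
abbrev Presc1 (t : ℕ) : Type u := M.X t → FinDist (M.U1 t)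

/-- Prescriptions of virtual player 2. As player 2 has no private information, these are
distributions over actions. -/
abbrev Presc2 (t : ℕ) : Type u := FinDist (M.U2 t)

/-- Strategies of virtual player 1. -/
abbrev VStrategy1 : Type u := ∀ t, M.Common t → M.Presc1 t

/-- Strategies of virtual player 2. -/
abbrev VStrategy2 : Type u := ∀ t, M.Common t → M.Presc2 t

/-- The cost of the virtual game: the prescriptions are selected from the common information, and
the actions are drawn from the prescriptions, applied to the private information. -/
def virtualJ (χ₁ : M.VStrategy1) (χ₂ : M.VStrategy2) : ℝ :=
  M.expectedCost (fun t h => χ₁ t (M.common h) (M.state h)) (fun t h => χ₂ t (M.common h))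

/-! ### Strategies of the expanded virtual game -/

/-- Prescription histories `(γ¹_{0:t-1}, γ²_{0:t-1})`. -/
def PrescHist : ℕ → Type u
  | 0 => PUnit
  | t + 1 => PrescHist t × (M.Presc1 t × M.Presc2 t)

/-- Strategies of virtual player 1 in the expanded game. -/
abbrev EStrategy1 : Type u := ∀ t, M.Common t → M.PrescHist t → M.Presc1 t

/-- Strategies of virtual player 2 in the expanded game. -/
abbrev EStrategy2 : Type u := ∀ t, M.Common t → M.PrescHist t → M.Presc2 t

/-- The prescription history that a profile of the expanded game generates along a realization
of the common information. -/
def realizedPresc (e₁ : M.EStrategy1) (e₂ : M.EStrategy2) : ∀ t, M.Common t → M.PrescHist t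
  | 0, _ => PUnit.unit
  | t + 1, (c, _) =>
    (realizedPresc e₁ e₂ t c,
      (e₁ t c (realizedPresc e₁ e₂ t c), e₂ t c (realizedPresc e₁ e₂ t c)))

/-- The operator `ϱ¹` from profiles of the expanded game to strategies of virtual player 1 in the
virtual game. -/
def rho1 (e₁ : M.EStrategy1) (e₂ : M.EStrategy2) : M.VStrategy1 :=
  fun t c => e₁ t c (M.realizedPresc e₁ e₂ t c)

/-! ### Common information beliefs -/

/-- Beliefs on the state (the only private information). -/
abbrev Belief (t : ℕ) : Type u := FinDist (M.X t)

/-- `Q_t(π, γ¹, z; x')` for the increment `z = (u₂, y)` of the common information. -/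
def beliefQ (t : ℕ) (π : M.Belief t) (γ₁ : M.Presc1 t) (u₂ : M.U2 t) (y : M.Y (t + 1))
    (x' : M.X (t + 1)) : ℝ :=
  ∑ x, ∑ u₁, π x * γ₁ x u₁ * M.transProb t x u₁ u₂ x' y

/-- `R_t(π, γ¹, z)`, the total mass of `Q_t(π, γ¹, z; ·)`. -/
def beliefR (t : ℕ) (π : M.Belief t) (γ₁ : M.Presc1 t) (u₂ : M.U2 t) (y : M.Y (t + 1)) : ℝ :=
  ∑ x', M.beliefQ t π γ₁ u₂ y x'

/-- Arbitrary beliefs to be adopted after observations of probability zero, where Bayes' rule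
does not apply. -/
structure DefaultBeliefs where
  /-- the default at the first stage -/
  init : M.Y 0 → M.Belief 0
  /-- the default at the later stages -/
  next : ∀ t, M.Belief t → M.Presc1 t → M.U2 t → M.Y (t + 1) → M.Belief (t + 1)

variable {M}

lemma initProb_nonneg (x : M.X 0) (y : M.Y 0) : 0 ≤ M.initProb x y := by
  refine mul_nonneg (M.initLaw.2.1 x) (Finset.sum_nonneg fun w _ => ?_)
  split_ifs
  · exact (M.woLaw 0).2.1 w
  · exact le_rfl

lemma transProb_nonneg (t : ℕ) (x : M.X t) (u₁ : M.U1 t) (u₂ : M.U2 t)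
    (x' : M.X (t + 1)) (y : M.Y (t + 1)) : 0 ≤ M.transProb t x u₁ u₂ x' y := by
  refine mul_nonneg (Finset.sum_nonneg fun w _ => ?_) (Finset.sum_nonneg fun w _ => ?_)
  · split_ifs
    · exact (M.wsLaw t).2.1 w
    · exact le_rfl
  · split_ifs
    · exact (M.woLaw (t + 1)).2.1 w
    · exact le_rfl

lemma beliefQ_nonneg (t : ℕ) (π : M.Belief t) (γ₁ : M.Presc1 t) (u₂ : M.U2 t) (y : M.Y (t + 1))
    (x' : M.X (t + 1)) : 0 ≤ M.beliefQ t π γ₁ u₂ y x' :=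
  Finset.sum_nonneg fun x _ => Finset.sum_nonneg fun u₁ _ =>
    mul_nonneg (mul_nonneg (π.2.1 x) ((γ₁ x).2.1 u₁)) (transProb_nonneg t x u₁ u₂ x' y)

variable (d : M.DefaultBeliefs)

open Classical in
/-- The belief at the first stage, after the observation `y`. -/
def initBelief (y : M.Y 0) : M.Belief 0 :=
  if hy : 0 < ∑ x, M.initProb x y then
    ⟨fun x => M.initProb x y / ∑ x, M.initProb x y,
      fun x => div_nonneg (initProb_nonneg x y) hy.le,
      by rw [← Finset.sum_div, div_self hy.ne']⟩
  else d.init y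

open Classical in
/-- The belief update rule `F_t(π, γ¹, z)`, for `z = (u₂, y)`; it does not use the prescription of
virtual player 2. -/
def nextBelief (t : ℕ) (π : M.Belief t) (γ₁ : M.Presc1 t) (u₂ : M.U2 t) (y : M.Y (t + 1)) :
    M.Belief (t + 1) :=
  if hR : 0 < M.beliefR t π γ₁ u₂ y then
    ⟨fun x' => M.beliefQ t π γ₁ u₂ y x' / M.beliefR t π γ₁ u₂ y,
      fun x' => div_nonneg (beliefQ_nonneg t π γ₁ u₂ y x') hR.le,
      by rw [← Finset.sum_div]; exact div_self hR.ne'⟩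
  else d.next t π γ₁ u₂ y

/-- The common information belief, as a function of the information in the expanded game. -/
def belief : ∀ t, M.Common t → M.PrescHist t → M.Belief t
  | 0, y, _ => initBelief d y
  | t + 1, (c, u₂, y), (p, γ₁, _) => nextBelief d t (belief t c p) γ₁ u₂ y

/-! ### The dynamic programs -/

/-- The expected stage cost `c̃_t(π, γ¹, γ²)`. -/
def stageCost (t : ℕ) (π : M.Belief t) (γ₁ : M.Presc1 t) (γ₂ : M.Presc2 t) : ℝ :=
  ∑ x, ∑ u₁, ∑ u₂, M.cost t x u₁ u₂ * π x * γ₁ x u₁ * γ₂ u₂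

/-- `c̃_t(π, γ¹, γ²) + 𝔼[V(F_t(π, γ¹, Z_{t+1})) | π, γ¹, γ²]`. The increment `z = (u₂, y)` of
the common information has the conditional probability `γ²(u₂) R_t(π, γ¹, z)`. -/
def stageObjective (t : ℕ) (V : M.Belief (t + 1) → ℝ) (π : M.Belief t)
    (γ₁ : M.Presc1 t) (γ₂ : M.Presc2 t) : ℝ :=
  stageCost t π γ₁ γ₂ +
    ∑ u₂, ∑ y, γ₂ u₂ * M.beliefR t π γ₁ u₂ y * V (nextBelief d t π γ₁ u₂ y)

/-- The min-max value function at stage `t` when `k` stages remain. -/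
def minmaxValue : ℕ → ∀ t, M.Belief t → ℝ
  | 0, _, _ => 0
  | k + 1, t, π => ⨅ γ₁ : M.Presc1 t, ⨆ γ₂ : M.Presc2 t,
      stageObjective d t (minmaxValue k (t + 1)) π γ₁ γ₂

/-- The max-min value function at stage `t` when `k` stages remain. -/
def maxminValue : ℕ → ∀ t, M.Belief t → ℝ
  | 0, _, _ => 0
  | k + 1, t, π => ⨆ γ₂ : M.Presc2 t, ⨅ γ₁ : M.Presc1 t,
      stageObjective d t (maxminValue k (t + 1)) π γ₁ γ₂

/-- `V^u_t`; it is `0` for `t = T`. -/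
def Vu (t : ℕ) (π : M.Belief t) : ℝ := minmaxValue d (M.T - t) t π

/-- `w^u_t`. -/
def wu (t : ℕ) (π : M.Belief t) (γ₁ : M.Presc1 t) (γ₂ : M.Presc2 t) : ℝ :=
  stageObjective d t (Vu d (t + 1)) π γ₁ γ₂

/-- `V^l_t`; it is `0` for `t = T`. -/
def Vl (t : ℕ) (π : M.Belief t) : ℝ := maxminValue d (M.T - t) t π

/-- `w^l_t`. -/
def wl (t : ℕ) (π : M.Belief t) (γ₁ : M.Presc1 t) (γ₂ : M.Presc2 t) : ℝ :=
  stageObjective d t (Vl d (t + 1)) π γ₁ γ₂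

/-- `ψ` solves the min-max dynamic program: `V^u_t(π) = max_{γ²} w^u_t(π, ψ_t(π), γ²)`. -/
def IsMinmaxSolution (ψ : ∀ t, M.Belief t → M.Presc1 t) : Prop :=
  ∀ t < M.T, ∀ π : M.Belief t,
    IsGreatest (Set.range fun γ₂ : M.Presc2 t => wu d t π (ψ t π) γ₂) (Vu d t π)

/-- `φ` solves the max-min dynamic program: `V^l_t(π) = min_{γ¹} w^l_t(π, γ¹, φ_t(π))`. -/
def IsMaxminSolution (φ : ∀ t, M.Belief t → M.Presc2 t) : Prop :=
  ∀ t < M.T, ∀ π : M.Belief t,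
    IsLeast (Set.range fun γ₁ : M.Presc1 t => wl d t π γ₁ (φ t π)) (Vl d t π)

/-- The strategy of virtual player 1 in the expanded game that applies `ψ` to the common
information belief. -/
def beliefEStrategy1 (ψ : ∀ t, M.Belief t → M.Presc1 t) : M.EStrategy1 :=
  fun t c p => ψ t (belief d t c p)

/-- The strategy of virtual player 2 in the expanded game that applies `φ` to the common
information belief. -/
def beliefEStrategy2 (φ : ∀ t, M.Belief t → M.Presc2 t) : M.EStrategy2 :=
  fun t c p => φ t (belief d t c p)

/-! ### Common-information-belief-based strategies -/

open Classical in
/-- `ℙ[X_t = x, C_t = c]` when the original game is played with the profile `(g₁, g₂)`. -/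
def stateCommonProb (g₁ : M.Strategy1) (g₂ : M.Strategy2) (t : ℕ) (x : M.X t)
    (c : M.Common t) : ℝ :=
  ∑ h : M.Hist t, if M.state h = x ∧ M.common h = c then
    M.pathLaw g₁ (fun s k => g₂ s (M.common k)) t h else 0

/-- `ℙ[C_t = c]` when the original game is played with the profile `(g₁, g₂)`. -/
def commonProb (g₁ : M.Strategy1) (g₂ : M.Strategy2) (t : ℕ) (c : M.Common t) : ℝ :=
  ∑ x, stateCommonProb g₁ g₂ t x c

/-- Against every strategy of player 2, the reduced strategy `g` selects player 1's distribution
over actions by applying the fixed maps `ψ t` to the conditional law of the state given the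
common information, and the result to the state. -/
def IsBeliefBased (ψ : ∀ t, M.Belief t → M.Presc1 t) (g : M.ReducedStrategy1) : Prop :=
  ∀ g₂ : M.Strategy2, ∀ t < M.T, ∀ c : M.Common t, 0 < commonProb g.toStrategy1 g₂ t c →
    ∃ π : M.Belief t,
      (∀ x, π x = stateCommonProb g.toStrategy1 g₂ t x c / commonProb g.toStrategy1 g₂ t c) ∧
      ∀ x, g t x c = ψ t π x

end GameModel

end

noncomputable section

/-! The number `gameValue` is the expectation of `Vu d 0` at the first belief. It suffices that `g`
guarantees at most this cost in the original game and that player 2 has one strategy guaranteeing at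
least this cost. The reduced and virtual games have the same cost with fewer strategies of player 1,
so both guarantees carry over to them.

For any `g₁`, average the action laws over the histories with the same state and common information
(`exists_isConditionalPresc`). The resulting prescriptions `γ` do not depend on player 2, whose
contribution to the law of a history is a function of the common information. Hence Bayes' rule
driven by `γ` gives the conditional law of the state against every `g₂`
(`isConsistent_beliefAlong`). The expected cost so far plus `Vu` at the belief starts at `gameValue`
and ends at the cost of the play; by `expectedValue_succ`, its steps have the sign of `wu - Vu`. A
min-max solution makes every step nonpositive, which is the guarantee of player 1.

If `g₁` is known, player 2 can compute `γ` and the beliefs, and make every step nonnegative by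
maximizing `wu`. This reply depends on `g₁`. To remove the dependence, `exists_saddle_J` applies
Sion's theorem to realization plans, in which the cost is bilinear: the tailored reply to the saddle
strategy of player 1 shows that the saddle value is at least `gameValue`, so the saddle strategy of
player 2 guarantees this much against everyone.

The programs have solutions by compactness: the belief update jumps only where its weight in the
objective vanishes (`continuous_beliefR_mul`). -/

/-- If player 1 can guarantee `v` with `a` and player 2 can guarantee `v` with `b`, then `a` is a
minimax strategy and an equilibrium strategy. -/
lemma isMinimaxStrategy_and_isEquilibriumStrategy {A B : Type*} {J : A → B → ℝ} {a : A} {b : B}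
    {v : ℝ} (hJ : ∀ a, BddAbove (Set.range (J a))) (ha : ∀ b', J a b' ≤ v) (hb : ∀ a', v ≤ J a' b) :
    IsMinimaxStrategy J a ∧ IsEquilibriumStrategy J a := by
  have : Nonempty A := ⟨a⟩
  have : Nonempty B := ⟨b⟩
  have hle : ∀ a', v ≤ ⨆ b', J a' b' := fun a' => (hb a').trans (le_ciSup (hJ a') b)
  have hv : ⨆ b', J a b' = v := le_antisymm (ciSup_le ha) (hle a)
  refine ⟨?_, b, fun b' => (ha b').trans (hb a), fun a' => (ha b).trans (hb a')⟩
  refine le_antisymm (le_ciInf fun a' => hv.trans_le (hle a')) ?_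
  exact ciInf_le ⟨v, Set.forall_mem_range.2 hle⟩ a

lemma FinDist.continuous_apply {α : Type*} [Fintype α] (x : α) :
    Continuous fun p : FinDist α => p x :=
  (_root_.continuous_apply x).comp continuous_subtype_val

lemma FinDist.nonneg {α : Type*} [Fintype α] (p : FinDist α) (x : α) : 0 ≤ p x := p.2.1 x

lemma FinDist.sum_eq_one {α : Type*} [Fintype α] (p : FinDist α) : ∑ x, p x = 1 := p.2.2

/-! ### Realization plans of behavioral strategies with perfect recall -/

section RealizationPlan

variable {K A : ℕ → Type u} [∀ t, Fintype (A t)]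
  (pred : ∀ t, K (t + 1) → K t) (act : ∀ t, K (t + 1) → A t)

/-- The contribution of the behavioral strategy `b` to the probability of reaching an information
state. The predecessor of an information state and the action taken there are `pred` and `act`. -/
def realizationPlan (b : ∀ t, K t → FinDist (A t)) : ∀ t, K t → ℝ
  | 0, _ => 1
  | t + 1, k => realizationPlan b t (pred t k) * b t (pred t k) (act t k)

lemma realizationPlan_nonneg (b : ∀ t, K t → FinDist (A t)) :
    ∀ t k, 0 ≤ realizationPlan pred act b t k
  | 0, _ => zero_le_one
  | t + 1, _ => mul_nonneg (realizationPlan_nonneg b t _) (FinDist.nonneg _ _)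

lemma continuous_realizationPlan : ∀ t k,
    Continuous fun b : ∀ t, K t → FinDist (A t) => realizationPlan pred act b t k
  | 0, _ => continuous_const
  | t + 1, k => by
    refine (continuous_realizationPlan t (pred t k)).mul ?_
    exact (FinDist.continuous_apply (act t k)).comp
      ((continuous_apply (pred t k)).comp (continuous_apply t))

/-- A mixture of two behavioral strategies has a behavioral equivalent. -/
lemma exists_realizationPlan_eq_mixture (b b' : ∀ t, K t → FinDist (A t)) {r r' : ℝ}
    (hr : 0 ≤ r) (hr' : 0 ≤ r') (hrr : r + r' = 1) :
    ∃ b'' : ∀ t, K t → FinDist (A t), ∀ t k, realizationPlan pred act b'' t k =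
      r * realizationPlan pred act b t k + r' * realizationPlan pred act b' t k := by
  -- At each information state the equivalent strategy averages the two local laws, weighted by the
  -- mixture probability times each strategy's contribution to reaching that state. The product form
  -- also covers unreached states, where any law will do.
  have key : ∀ t k, ∃ p : FinDist (A t), ∀ u,
      (r * realizationPlan pred act b t k + r' * realizationPlan pred act b' t k) * p u =
        r * realizationPlan pred act b t k * b t k u +
          r' * realizationPlan pred act b' t k * b' t k u := by
    intro t k
    have h₁ := mul_nonneg hr (realizationPlan_nonneg pred act b t k)
    have h₂ := mul_nonneg hr' (realizationPlan_nonneg pred act b' t k)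
    generalize r * realizationPlan pred act b t k = s at *
    generalize r' * realizationPlan pred act b' t k = s' at *
    rcases (add_nonneg h₁ h₂).eq_or_lt with h | h
    · obtain ⟨rfl, rfl⟩ : s = 0 ∧ s' = 0 := ⟨by linarith, by linarith⟩
      exact ⟨b t k, fun u => by ring⟩
    · refine ⟨⟨fun u => (s * b t k u + s' * b' t k u) / (s + s'), fun u => div_nonneg
        (add_nonneg (mul_nonneg h₁ (FinDist.nonneg _ _)) (mul_nonneg h₂ (FinDist.nonneg _ _)))
        h.le, ?_⟩, fun u => mul_div_cancel₀ _ h.ne'⟩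
      rw [← Finset.sum_div, Finset.sum_add_distrib, ← Finset.mul_sum, ← Finset.mul_sum,
        FinDist.sum_eq_one, FinDist.sum_eq_one, mul_one, mul_one, div_self h.ne']
  choose b'' hb'' using key
  refine ⟨b'', fun t => ?_⟩
  induction t with
  | zero => intro k; simp [realizationPlan, hrr]
  | succ t ih =>
    intro k
    simp only [realizationPlan]
    rw [ih, hb'']
    ring

lemma convex_range_realizationPlan (t : ℕ) :
    Convex ℝ (Set.range fun b : ∀ t, K t → FinDist (A t) => realizationPlan pred act b t) := by
  rintro _ ⟨b, rfl⟩ _ ⟨b', rfl⟩ r r' hr hr' hrr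
  obtain ⟨b'', h⟩ := exists_realizationPlan_eq_mixture pred act b b' hr hr' hrr
  exact ⟨b'', funext fun k => by simp [h]⟩

/-- Tychonoff: the strategies form a product of simplices, and the plan depends continuously on
them. -/
lemma isCompact_range_realizationPlan (t : ℕ) :
    IsCompact (Set.range fun b : ∀ t, K t → FinDist (A t) => realizationPlan pred act b t) :=
  isCompact_range (continuous_pi fun k => continuous_realizationPlan pred act t k)

end RealizationPlan

/-! ### Bilinearity of the cost in realization plans, and a saddle point of the original game -/

namespace GameModel

variable {M : GameModel.{u}}

/-- The realization plan of a strategy of player 1. -/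
def plan1 (g₁ : M.Strategy1) (t : ℕ) (h : M.Hist t) : ℝ :=
  realizationPlan (K := M.Hist) (A := M.U1) (fun _ k => k.1) (fun _ k => k.2.1) g₁ t h

/-- The realization plan of a strategy of player 2. -/
def plan2 (g₂ : M.Strategy2) (t : ℕ) (c : M.Common t) : ℝ :=
  realizationPlan (K := M.Common) (A := M.U2) (fun _ k => k.1) (fun _ k => k.2.1) g₂ t c

/-- The contribution of chance to the probability of a history. -/
def natureProb : ∀ t, M.Hist t → ℝ
  | 0, h => M.initProb h.1 h.2
  | t + 1, (h, u₁, u₂, x', y) => natureProb t h * M.transProb t (M.state h) u₁ u₂ x' y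

lemma natureProb_nonneg : ∀ t (h : M.Hist t), 0 ≤ natureProb t h
  | 0, _ => initProb_nonneg _ _
  | t + 1, (h, _, _, _, _) => mul_nonneg (natureProb_nonneg t h) (transProb_nonneg ..)

/-- The law of the history against `g₂`. -/
abbrev law (g₁ : M.Strategy1) (g₂ : M.Strategy2) (t : ℕ) (h : M.Hist t) : ℝ :=
  M.pathLaw g₁ (fun s k => g₂ s (M.common k)) t h

/-- Each stage multiplies the law by one factor from each player and one from chance. Because the
plan of player 2 sees only the common information, it can later be pulled out of any conditioning on
that information. -/
lemma law_eq (g₁ : M.Strategy1) (g₂ : M.Strategy2) : ∀ t (h : M.Hist t),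
    law g₁ g₂ t h = plan1 g₁ t h * natureProb t h * plan2 g₂ t (M.common h)
  | 0, h => by simp [law, pathLaw, plan1, plan2, natureProb, realizationPlan]
  | t + 1, (h, u₁, u₂, x', y) => by
    have ih := law_eq g₁ g₂ t h
    simp only [law, pathLaw, plan1, plan2, natureProb, realizationPlan, common] at ih ⊢
    rw [ih]
    ring

lemma law_nonneg (g₁ : M.Strategy1) (g₂ : M.Strategy2) (t : ℕ) (h : M.Hist t) :
    0 ≤ law g₁ g₂ t h := by
  rw [law_eq]
  exact mul_nonneg (mul_nonneg (realizationPlan_nonneg ..) (natureProb_nonneg t h))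
    (realizationPlan_nonneg ..)

/-- The expected cost in terms of realization plans. -/
def planCost (p : M.Hist M.T → ℝ) (q : M.Common M.T → ℝ) : ℝ :=
  ∑ h, p h * natureProb M.T h * q (M.common h) * M.totalCost M.T h

lemma J_eq_planCost (g₁ : M.Strategy1) (g₂ : M.Strategy2) :
    M.J g₁ g₂ = planCost (plan1 g₁ M.T) (plan2 g₂ M.T) :=
  Finset.sum_congr rfl fun h _ => by rw [← law_eq]

lemma continuous_planCost_left (q : M.Common M.T → ℝ) : Continuous fun p => planCost p q := by
  unfold planCost; fun_prop

lemma continuous_planCost_right (p : M.Hist M.T → ℝ) : Continuous fun q => planCost p q := by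
  unfold planCost; fun_prop

lemma planCost_add_smul_left (p p' : M.Hist M.T → ℝ) (q : M.Common M.T → ℝ) (r r' : ℝ) :
    planCost (r • p + r' • p') q = r * planCost p q + r' * planCost p' q := by
  simp only [planCost, Finset.mul_sum, ← Finset.sum_add_distrib, Pi.add_apply, Pi.smul_apply,
    smul_eq_mul]
  exact Finset.sum_congr rfl fun _ _ => by ring

lemma planCost_add_smul_right (p : M.Hist M.T → ℝ) (q q' : M.Common M.T → ℝ) (r r' : ℝ) :
    planCost p (r • q + r' • q') = r * planCost p q + r' * planCost p q' := by
  simp only [planCost, Finset.mul_sum, ← Finset.sum_add_distrib, Pi.add_apply, Pi.smul_apply,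
    smul_eq_mul]
  exact Finset.sum_congr rfl fun _ _ => by ring

lemma continuous_J (g₁ : M.Strategy1) : Continuous (M.J g₁) := by
  rw [funext fun g₂ => J_eq_planCost g₁ g₂]
  exact (continuous_planCost_right _).comp
    (continuous_pi fun c => continuous_realizationPlan _ _ M.T c)

/-- Ensures that the real-valued `⨆` over player 2's strategies is a genuine supremum and not the
default value `0`. -/
lemma bddAbove_range_J (g₁ : M.Strategy1) : BddAbove (Set.range (M.J g₁)) :=
  (isCompact_range (continuous_J g₁)).bddAbove

/-- The game in which player 1 has complete information has a Nash equilibrium. -/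
lemma exists_saddle_J : ∃ (a : M.Strategy1) (b : M.Strategy2),
    ∀ a' b', M.J a b' ≤ M.J a' b := by
  -- Sion's theorem is applied to the sets of plans, which are convex and compact; in behavioral
  -- strategies the cost need not be quasiconvex or quasiconcave.
  obtain ⟨_, ⟨a, rfl⟩, _, ⟨b, rfl⟩, h⟩ := Sion.exists_isSaddlePointOn
    (X := Set.range fun a : M.Strategy1 => plan1 a M.T)
    (Y := Set.range fun b : M.Strategy2 => plan2 b M.T)
    (f := planCost)
    (Set.range_nonempty _) (convex_range_realizationPlan _ _ M.T)
    (isCompact_range_realizationPlan _ _ M.T)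
    (fun q _ => (continuous_planCost_left q).lowerSemicontinuous.lowerSemicontinuousOn _)
    (fun q _ => ConvexOn.quasiconvexOn ⟨convex_range_realizationPlan _ _ M.T,
      fun p _ p' _ r r' _ _ _ => (planCost_add_smul_left p p' q r r').le⟩)
    (convex_range_realizationPlan _ _ M.T) (Set.range_nonempty _)
    (isCompact_range_realizationPlan _ _ M.T)
    (fun p _ => (continuous_planCost_right p).upperSemicontinuous.upperSemicontinuousOn _)
    (fun p _ => ConcaveOn.quasiconcaveOn ⟨convex_range_realizationPlan _ _ M.T,
      fun q _ q' _ r r' _ _ _ => (planCost_add_smul_right p q q' r r').ge⟩)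
  refine ⟨a, b, fun a' b' => ?_⟩
  rw [J_eq_planCost, J_eq_planCost]
  exact h _ ⟨a', rfl⟩ _ ⟨b', rfl⟩

end GameModel

/-! ### Solutions of the dynamic programs -/

lemma continuous_iSup_of_compact {α β : Type*} [TopologicalSpace α] [TopologicalSpace β]
    [CompactSpace β] {f : α → β → ℝ} (hf : Continuous fun p : α × β => f p.1 p.2) :
    Continuous fun a => ⨆ b, f a b := by
  simpa only [Set.image_univ, sSup_range] using isCompact_univ.continuous_sSup hf

lemma continuous_iInf_of_compact {α β : Type*} [TopologicalSpace α] [TopologicalSpace β]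
    [CompactSpace β] {f : α → β → ℝ} (hf : Continuous fun p : α × β => f p.1 p.2) :
    Continuous fun a => ⨅ b, f a b := by
  simpa only [Set.image_univ, sInf_range] using isCompact_univ.continuous_sInf hf

lemma isGreatest_range_ciSup {β : Type*} [TopologicalSpace β] [CompactSpace β] [Nonempty β]
    {f : β → ℝ} (hf : Continuous f) : IsGreatest (Set.range f) (⨆ b, f b) :=
  (isCompact_range hf).isGreatest_sSup (Set.range_nonempty f)

lemma isLeast_range_ciInf {β : Type*} [TopologicalSpace β] [CompactSpace β] [Nonempty β]
    {f : β → ℝ} (hf : Continuous f) : IsLeast (Set.range f) (⨅ b, f b) :=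
  (isCompact_range hf).isLeast_sInf (Set.range_nonempty f)

namespace GameModel

variable {M : GameModel.{u}} (d : M.DefaultBeliefs)

lemma continuous_beliefQ (t : ℕ) (u₂ : M.U2 t) (y : M.Y (t + 1)) (x' : M.X (t + 1)) :
    Continuous fun p : M.Belief t × M.Presc1 t => M.beliefQ t p.1 p.2 u₂ y x' := by
  refine continuous_finsetSum _ fun x _ => continuous_finsetSum _ fun u₁ _ =>
    Continuous.mul (Continuous.mul ?_ ?_) continuous_const
  · exact (FinDist.continuous_apply x).comp continuous_fst
  · exact (FinDist.continuous_apply u₁).comp ((continuous_apply x).comp continuous_snd)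

lemma continuous_beliefR (t : ℕ) (u₂ : M.U2 t) (y : M.Y (t + 1)) :
    Continuous fun p : M.Belief t × M.Presc1 t => M.beliefR t p.1 p.2 u₂ y :=
  continuous_finsetSum _ fun x' _ => continuous_beliefQ t u₂ y x'

lemma beliefR_nonneg (t : ℕ) (π : M.Belief t) (γ₁ : M.Presc1 t) (u₂ : M.U2 t) (y : M.Y (t + 1)) :
    0 ≤ M.beliefR t π γ₁ u₂ y :=
  Finset.sum_nonneg fun _ _ => beliefQ_nonneg ..

/-- Bayes' rule without division. If the mass `R` vanishes, so does every nonnegative term of `Q`;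
hence the identity holds for any default belief. -/
lemma beliefQ_eq_mul (t : ℕ) (π : M.Belief t) (γ₁ : M.Presc1 t) (u₂ : M.U2 t)
    (y : M.Y (t + 1)) (x' : M.X (t + 1)) :
    M.beliefQ t π γ₁ u₂ y x' = M.beliefR t π γ₁ u₂ y * nextBelief d t π γ₁ u₂ y x' := by
  rcases (beliefR_nonneg t π γ₁ u₂ y).eq_or_lt with h | h
  · rw [← h, zero_mul]
    exact (Finset.sum_eq_zero_iff_of_nonneg fun x _ => beliefQ_nonneg t π γ₁ u₂ y x).1 h.symm x'
      (Finset.mem_univ _)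
  · rw [nextBelief, dif_pos h]
    exact (mul_div_cancel₀ _ h.ne').symm

/-- Although the belief update may be discontinuous at observations of probability zero, the
weighted continuation value is continuous. -/
lemma continuous_beliefR_mul {t : ℕ} {V : M.Belief (t + 1) → ℝ} (hV : Continuous V)
    (u₂ : M.U2 t) (y : M.Y (t + 1)) :
    Continuous fun p : M.Belief t × M.Presc1 t =>
      M.beliefR t p.1 p.2 u₂ y * V (nextBelief d t p.1 p.2 u₂ y) := by
  have hRc := continuous_beliefR (M := M) t u₂ y
  obtain ⟨C, hC⟩ := (isCompact_range hV).isBounded.exists_norm_le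
  rw [continuous_iff_continuousAt]
  intro p
  rcases (beliefR_nonneg t p.1 p.2 u₂ y).eq_or_lt with h | h
  · rw [ContinuousAt, ← h, zero_mul]
    -- Where the weight vanishes, the bound `C` on `V` suffices, whatever the updated belief does.
    refine squeeze_zero_norm (a := fun p => M.beliefR t p.1 p.2 u₂ y * C) (fun q => ?_) ?_
    · rw [norm_mul, Real.norm_of_nonneg (beliefR_nonneg ..)]
      exact mul_le_mul_of_nonneg_left (hC _ ⟨_, rfl⟩) (beliefR_nonneg ..)
    · have := (hRc.tendsto p).mul_const C
      rwa [← h, zero_mul] at this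
  -- Where the weight is positive it stays so nearby, and the update is a quotient of continuous
  -- functions.
  · have hpos : ∀ᶠ q in nhds p, 0 < M.beliefR t q.1 q.2 u₂ y :=
      hRc.continuousAt.eventually (lt_mem_nhds h)
    refine hRc.continuousAt.mul (hV.continuousAt.comp ?_)
    rw [ContinuousAt, tendsto_subtype_rng, tendsto_pi_nhds]
    intro x'
    have hx : ∀ q : M.Belief t × M.Presc1 t, 0 < M.beliefR t q.1 q.2 u₂ y →
        (nextBelief d t q.1 q.2 u₂ y).1 x' =
          M.beliefQ t q.1 q.2 u₂ y x' / M.beliefR t q.1 q.2 u₂ y := fun q hq => by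
      rw [nextBelief, dif_pos hq]
    rw [hx p h]
    refine Filter.Tendsto.congr' ?_
      (((continuous_beliefQ t u₂ y x').tendsto p).div (hRc.tendsto p) h.ne')
    filter_upwards [hpos] with q hq using (hx q hq).symm

lemma continuous_stageObjective {t : ℕ} {V : M.Belief (t + 1) → ℝ} (hV : Continuous V) :
    Continuous fun p : (M.Belief t × M.Presc1 t) × M.Presc2 t =>
      stageObjective d t V p.1.1 p.1.2 p.2 := by
  have h₂ : ∀ u₂, Continuous fun p : (M.Belief t × M.Presc1 t) × M.Presc2 t => p.2 u₂ :=
    fun u₂ => (FinDist.continuous_apply u₂).comp continuous_snd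
  refine Continuous.add ?_ ?_
  · refine continuous_finsetSum _ fun x _ => continuous_finsetSum _ fun u₁ _ =>
      continuous_finsetSum _ fun u₂ _ =>
      ((continuous_const.mul ?_).mul ?_).mul (h₂ u₂)
    · exact (FinDist.continuous_apply x).comp (continuous_fst.comp continuous_fst)
    · exact (FinDist.continuous_apply u₁).comp
        ((continuous_apply x).comp (continuous_snd.comp continuous_fst))
  · refine continuous_finsetSum _ fun u₂ _ => continuous_finsetSum _ fun y _ => ?_
    simp only [mul_assoc]
    exact (h₂ u₂).mul ((continuous_beliefR_mul d hV u₂ y).comp continuous_fst)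

lemma continuous_minmaxValue : ∀ k t, Continuous (minmaxValue d k t)
  | 0, _ => continuous_const
  | k + 1, t => by
    have := continuous_stageObjective d (continuous_minmaxValue k (t + 1))
    exact continuous_iInf_of_compact (continuous_iSup_of_compact this)

lemma continuous_maxminValue : ∀ k t, Continuous (maxminValue d k t)
  | 0, _ => continuous_const
  | k + 1, t => by
    have h := continuous_stageObjective d (continuous_maxminValue k (t + 1))
    refine continuous_iSup_of_compact (f := fun π γ₂ => ⨅ γ₁ : M.Presc1 t, _)
      (continuous_iInf_of_compact (α := M.Belief t × M.Presc2 t)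
        (f := fun p γ₁ => stageObjective d t (maxminValue d k (t + 1)) p.1 γ₁ p.2) ?_)
    exact h.comp (f := fun p : (M.Belief t × M.Presc2 t) × M.Presc1 t => ((p.1.1, p.2), p.1.2))
      (by fun_prop)

lemma continuous_wu (t : ℕ) : Continuous fun p : (M.Belief t × M.Presc1 t) × M.Presc2 t =>
    wu d t p.1.1 p.1.2 p.2 :=
  continuous_stageObjective d (continuous_minmaxValue d _ _)

lemma continuous_wl (t : ℕ) : Continuous fun p : (M.Belief t × M.Presc1 t) × M.Presc2 t =>
    wl d t p.1.1 p.1.2 p.2 :=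
  continuous_stageObjective d (continuous_maxminValue d _ _)

/-- For `t < M.T` at least one stage remains, so the recursion unfolds once; at the horizon the
value is `0` instead. -/
lemma Vu_eq {t : ℕ} (ht : t < M.T) (π : M.Belief t) :
    Vu d t π = ⨅ γ₁ : M.Presc1 t, ⨆ γ₂ : M.Presc2 t, wu d t π γ₁ γ₂ := by
  obtain ⟨k, hk⟩ : ∃ k, M.T - t = k + 1 := ⟨M.T - t - 1, by omega⟩
  have hk' : M.T - (t + 1) = k := by omega
  have hV : Vu d (t + 1) = minmaxValue d k (t + 1) := funext fun π => by rw [Vu, hk']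
  rw [Vu, hk]
  simp only [wu, hV, minmaxValue]

lemma Vl_eq {t : ℕ} (ht : t < M.T) (π : M.Belief t) :
    Vl d t π = ⨆ γ₂ : M.Presc2 t, ⨅ γ₁ : M.Presc1 t, wl d t π γ₁ γ₂ := by
  obtain ⟨k, hk⟩ : ∃ k, M.T - t = k + 1 := ⟨M.T - t - 1, by omega⟩
  have hk' : M.T - (t + 1) = k := by omega
  have hV : Vl d (t + 1) = maxminValue d k (t + 1) := funext fun π => by rw [Vl, hk']
  rw [Vl, hk]
  simp only [wl, hV, maxminValue]

lemma isGreatest_range_wu {t : ℕ} (π : M.Belief t) (γ₁ : M.Presc1 t) :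
    IsGreatest (Set.range fun γ₂ : M.Presc2 t => wu d t π γ₁ γ₂)
      (⨆ γ₂ : M.Presc2 t, wu d t π γ₁ γ₂) :=
  isGreatest_range_ciSup (f := fun γ₂ => wu d t π γ₁ γ₂) ((continuous_wu d t).comp
    (f := fun γ₂ : M.Presc2 t => ((π, γ₁), γ₂)) (by fun_prop))

lemma isLeast_range_iSup_wu {t : ℕ} (ht : t < M.T) (π : M.Belief t) :
    IsLeast (Set.range fun γ₁ : M.Presc1 t => ⨆ γ₂ : M.Presc2 t, wu d t π γ₁ γ₂) (Vu d t π) := by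
  rw [Vu_eq d ht]
  refine isLeast_range_ciInf (continuous_iSup_of_compact
    (f := fun (γ₁ : M.Presc1 t) (γ₂ : M.Presc2 t) => wu d t π γ₁ γ₂) ?_)
  exact (continuous_wu d t).comp
    (f := fun p : M.Presc1 t × M.Presc2 t => ((π, p.1), p.2)) (by fun_prop)

lemma isLeast_range_wl {t : ℕ} (π : M.Belief t) (γ₂ : M.Presc2 t) :
    IsLeast (Set.range fun γ₁ : M.Presc1 t => wl d t π γ₁ γ₂)
      (⨅ γ₁ : M.Presc1 t, wl d t π γ₁ γ₂) :=
  isLeast_range_ciInf (f := fun γ₁ => wl d t π γ₁ γ₂) ((continuous_wl d t).comp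
    (f := fun γ₁ : M.Presc1 t => ((π, γ₁), γ₂)) (by fun_prop))

lemma isGreatest_range_iInf_wl {t : ℕ} (ht : t < M.T) (π : M.Belief t) :
    IsGreatest (Set.range fun γ₂ : M.Presc2 t => ⨅ γ₁ : M.Presc1 t, wl d t π γ₁ γ₂)
      (Vl d t π) := by
  rw [Vl_eq d ht]
  refine isGreatest_range_ciSup (continuous_iInf_of_compact
    (f := fun (γ₂ : M.Presc2 t) (γ₁ : M.Presc1 t) => wl d t π γ₁ γ₂) ?_)
  exact (continuous_wl d t).comp
    (f := fun p : M.Presc2 t × M.Presc1 t => ((π, p.2), p.1)) (by fun_prop)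

lemma exists_isMinmaxSolution : ∃ ψ : ∀ t, M.Belief t → M.Presc1 t, IsMinmaxSolution d ψ := by
  have h : ∀ t (π : M.Belief t), ∃ γ₁ : M.Presc1 t, t < M.T →
      IsGreatest (Set.range fun γ₂ : M.Presc2 t => wu d t π γ₁ γ₂) (Vu d t π) := by
    intro t π
    by_cases ht : t < M.T
    · obtain ⟨γ₁, hγ₁⟩ := (isLeast_range_iSup_wu d ht π).1
      exact ⟨γ₁, fun _ => hγ₁ ▸ isGreatest_range_wu d π γ₁⟩
    -- From the horizon on the program imposes no condition.
    · exact ⟨Classical.arbitrary _, fun h => absurd h ht⟩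
  choose ψ hψ using h
  exact ⟨ψ, fun t ht π => hψ t π ht⟩

lemma exists_isMaxminSolution : ∃ φ : ∀ t, M.Belief t → M.Presc2 t, IsMaxminSolution d φ := by
  have h : ∀ t (π : M.Belief t), ∃ γ₂ : M.Presc2 t, t < M.T →
      IsLeast (Set.range fun γ₁ : M.Presc1 t => wl d t π γ₁ γ₂) (Vl d t π) := by
    intro t π
    by_cases ht : t < M.T
    · obtain ⟨γ₂, hγ₂⟩ := (isGreatest_range_iInf_wl d ht π).1
      exact ⟨γ₂, fun _ => hγ₂ ▸ isLeast_range_wl d π γ₂⟩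
    · exact ⟨Classical.arbitrary _, fun h => absurd h ht⟩
  choose φ hφ using h
  exact ⟨φ, fun t ht π => hφ t π ht⟩

/-- Player 2 can achieve the min-max value against every known prescription of player 1. -/
lemma exists_Vu_le_wu {t : ℕ} (π : M.Belief t) (γ₁ : M.Presc1 t) :
    ∃ γ₂ : M.Presc2 t, t < M.T → Vu d t π ≤ wu d t π γ₁ γ₂ := by
  obtain ⟨γ₂, hγ₂⟩ := (isGreatest_range_wu d π γ₁).1
  exact ⟨γ₂, fun ht => ((isLeast_range_iSup_wu d ht π).2 ⟨γ₁, rfl⟩).trans_eq hγ₂.symm⟩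

end GameModel

namespace GameModel

variable {M : GameModel.{u}} (d : M.DefaultBeliefs)

/-! ### Evolution of the common information belief -/

open Classical in
lemma sum_transProb (t : ℕ) (x : M.X t) (u₁ : M.U1 t) (u₂ : M.U2 t) :
    ∑ x', ∑ y, M.transProb t x u₁ u₂ x' y = 1 := by
  have h : ∀ x', ∑ y, M.transProb t x u₁ u₂ x' y =
      ∑ w, if M.f t x u₁ u₂ w = x' then M.wsLaw t w else 0 := by
    intro x'
    simp only [transProb]
    rw [← Finset.mul_sum, Finset.sum_comm]
    simp
  simp only [h]
  rw [Finset.sum_comm]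
  simp

/-- The prescriptions `γ` describe the conditional laws of the actions of player 1, who uses `g₁`,
given the current state and the common information. -/
def IsConditionalPresc (g₁ : M.Strategy1) (γ : M.VStrategy1) : Prop :=
  ∀ (t : ℕ) (φ : M.X t → M.Common t → M.U1 t → ℝ),
    ∑ h, plan1 g₁ t h * natureProb t h * ∑ u₁, g₁ t h u₁ * φ (M.state h) (M.common h) u₁ =
      ∑ h, plan1 g₁ t h * natureProb t h *
        ∑ u₁, γ t (M.common h) (M.state h) u₁ * φ (M.state h) (M.common h) u₁

lemma isConditionalPresc_of_eq {g₁ : M.Strategy1} {γ : M.VStrategy1}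
    (h : ∀ t k, g₁ t k = γ t (M.common k) (M.state k)) : IsConditionalPresc g₁ γ := by
  intro t φ
  simp only [h]

-- The prescription is the average of `g₁` over the histories sharing `(c, x)`, weighted by the
-- contributions of player 1 and chance only. Leaving out player 2's factor, constant on each such
-- class, makes one `γ` serve against every `g₂`.
open Classical in
lemma exists_isConditionalPresc (g₁ : M.Strategy1) : ∃ γ, IsConditionalPresc g₁ γ := by
  have key : ∀ (t : ℕ) (c : M.Common t) (x : M.X t), ∃ p : FinDist (M.U1 t), ∀ u₁,
      ∑ h with (M.common h, M.state h) = (c, x), plan1 g₁ t h * natureProb t h * g₁ t h u₁ =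
        (∑ h with (M.common h, M.state h) = (c, x), plan1 g₁ t h * natureProb t h) * p u₁ := by
    intro t c x
    have h₀ : ∀ h : M.Hist t, 0 ≤ plan1 g₁ t h * natureProb t h := fun h =>
      mul_nonneg (realizationPlan_nonneg ..) (natureProb_nonneg t h)
    rcases (Finset.sum_nonneg fun (h : M.Hist t)
      (_ : h ∈ Finset.univ.filter fun h => (M.common h, M.state h) = (c, x)) =>
        h₀ h).eq_or_lt with hz | hpos
    -- No history in this class has positive weight, so both sides vanish for any law.
    · refine ⟨Classical.arbitrary _, fun u₁ => ?_⟩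
      rw [← hz, zero_mul]
      refine Finset.sum_eq_zero fun h hh => ?_
      rw [(Finset.sum_eq_zero_iff_of_nonneg fun h _ => h₀ h).1 hz.symm h hh, zero_mul]
    · refine ⟨⟨fun u₁ => (∑ h with (M.common h, M.state h) = (c, x),
        plan1 g₁ t h * natureProb t h * g₁ t h u₁) /
          ∑ h with (M.common h, M.state h) = (c, x), plan1 g₁ t h * natureProb t h,
        fun u₁ => div_nonneg (Finset.sum_nonneg fun h _ => mul_nonneg (h₀ h) (FinDist.nonneg _ _))
          hpos.le, ?_⟩, fun u₁ => (mul_div_cancel₀ _ hpos.ne').symm⟩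
      rw [← Finset.sum_div, Finset.sum_comm]
      simp only [← Finset.mul_sum, FinDist.sum_eq_one, mul_one]
      exact div_self hpos.ne'
  choose γ hγ using key
  refine ⟨γ, fun t φ => ?_⟩
  simp only [Finset.mul_sum]
  rw [Finset.sum_comm, Finset.sum_comm (s := Finset.univ (α := M.Hist t))]
  refine Finset.sum_congr rfl fun u₁ _ => ?_
  -- The classes are indexed by the attained pairs, since `M.Common t` carries no `Fintype`
  -- instance.
  let I : Finset (M.Common t × M.X t) := Finset.univ.image fun h => (M.common h, M.state h)
  have hI : ∀ h ∈ (Finset.univ : Finset (M.Hist t)), (M.common h, M.state h) ∈ I :=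
    fun h hh => Finset.mem_image_of_mem _ hh
  rw [← Finset.sum_fiberwise_of_maps_to hI, ← Finset.sum_fiberwise_of_maps_to hI]
  refine Finset.sum_congr rfl fun ⟨c, x⟩ _ => ?_
  calc _ = (∑ h with (M.common h, M.state h) = (c, x),
        plan1 g₁ t h * natureProb t h * g₁ t h u₁) * φ x c u₁ := by
        rw [Finset.sum_mul]
        refine Finset.sum_congr rfl fun h hh => ?_
        obtain ⟨rfl, rfl⟩ := Prod.mk.inj (Finset.mem_filter.1 hh).2
        ring
    _ = _ := by
        rw [hγ, Finset.sum_mul, Finset.sum_mul]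
        refine Finset.sum_congr rfl fun h hh => ?_
        obtain ⟨rfl, rfl⟩ := Prod.mk.inj (Finset.mem_filter.1 hh).2
        ring

/-- The common information belief generated by the prescriptions `γ`. -/
def beliefAlong (γ : M.VStrategy1) : ∀ t, M.Common t → M.Belief t
  | 0, y => initBelief d y
  | t + 1, (c, u₂, y) => nextBelief d t (beliefAlong γ t c) (γ t c) u₂ y

/-- The update ignores the prescriptions of virtual player 2, so along the realized prescriptions
only those of `rho1` matter. -/
lemma belief_realizedPresc (e₁ : M.EStrategy1) (e₂ : M.EStrategy2) : ∀ t (c : M.Common t),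
    belief d t c (M.realizedPresc e₁ e₂ t c) = beliefAlong d (M.rho1 e₁ e₂) t c
  | 0, _ => rfl
  | t + 1, (c, u₂, y) => by
    simp only [belief, realizedPresc, beliefAlong, rho1]
    rw [belief_realizedPresc e₁ e₂ t c]

lemma sum_hist_succ (t : ℕ) (F : M.Hist (t + 1) → ℝ) :
    ∑ h, F h = ∑ h : M.Hist t, ∑ u₁, ∑ u₂, ∑ x', ∑ y, F (h, u₁, u₂, x', y) := by
  refine (Fintype.sum_prod_type (f := fun h : M.Hist t ×
    (M.U1 t × M.U2 t × M.X (t + 1) × M.Y (t + 1)) => F h)).trans ?_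
  simp only [Fintype.sum_prod_type]

/-- Player 2's plan is a function of the common information and can be absorbed into the test
function of `IsConditionalPresc`. -/
lemma sum_law_presc {g₁ : M.Strategy1} {γ : M.VStrategy1} (hγ : IsConditionalPresc g₁ γ)
    (g₂ : M.Strategy2) (t : ℕ) (φ : M.X t → M.Common t → M.U1 t → ℝ) :
    ∑ h, law g₁ g₂ t h * ∑ u₁, g₁ t h u₁ * φ (M.state h) (M.common h) u₁ =
      ∑ h, law g₁ g₂ t h *
        ∑ u₁, γ t (M.common h) (M.state h) u₁ * φ (M.state h) (M.common h) u₁ := by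
  have := hγ t fun x c u₁ => plan2 g₂ t c * φ x c u₁
  simp only [mul_left_comm _ (plan2 g₂ t _), ← Finset.mul_sum] at this
  convert this using 2 <;> rw [law_eq] <;> ring

/-- The law of the state given the common information is `b`. -/
def IsConsistent (g₁ : M.Strategy1) (g₂ : M.Strategy2) (t : ℕ) (b : M.Common t → M.Belief t) :
    Prop :=
  ∀ φ : M.X t → M.Common t → ℝ, ∑ h, law g₁ g₂ t h * φ (M.state h) (M.common h) =
    ∑ h, law g₁ g₂ t h * ∑ x, b (M.common h) x * φ x (M.common h)

/-- One-step conditional expectations, given the common information. -/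
lemma sum_law_step {g₁ : M.Strategy1} {γ : M.VStrategy1} (hγ : IsConditionalPresc g₁ γ)
    {g₂ : M.Strategy2} {t : ℕ} {b : M.Common t → M.Belief t} (hb : IsConsistent g₁ g₂ t b)
    (φ : M.X t → M.U1 t → M.U2 t → M.X (t + 1) → M.Y (t + 1) → M.Common t → ℝ) :
    ∑ h : M.Hist t, ∑ u₁, ∑ u₂, ∑ x', ∑ y, law g₁ g₂ (t + 1) (h, u₁, u₂, x', y) *
        φ (M.state h) u₁ u₂ x' y (M.common h) =
      ∑ h : M.Hist t, law g₁ g₂ t h * ∑ x, ∑ u₁, ∑ u₂, ∑ x', ∑ y,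
        b (M.common h) x * γ t (M.common h) x u₁ * g₂ t (M.common h) u₂ *
          M.transProb t x u₁ u₂ x' y * φ x u₁ u₂ x' y (M.common h) := by
  -- Everything after player 1's action is integrated out. Then the law of the action is replaced by
  -- `γ`, and only afterwards the law of the state by `b`, since `γ` depends on the state.
  let Φ : M.X t → M.Common t → M.U1 t → ℝ := fun x c u₁ => ∑ u₂, ∑ x', ∑ y,
    g₂ t c u₂ * M.transProb t x u₁ u₂ x' y * φ x u₁ u₂ x' y c
  calc _ = ∑ h, law g₁ g₂ t h * ∑ u₁, g₁ t h u₁ * Φ (M.state h) (M.common h) u₁ := by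
        simp only [Φ, Finset.mul_sum, law, pathLaw]
        simp only [mul_assoc]
    _ = _ := sum_law_presc hγ g₂ t Φ
    _ = _ := hb fun x c => ∑ u₁, γ t c x u₁ * Φ x c u₁
    _ = _ := by
        simp only [Φ, Finset.mul_sum]
        simp only [mul_assoc]

/-- Summing out the old state and player 1's action produces `Q`, which splits into the weight `R`
of the new observation and the updated belief. Both the propagation of consistency and the Bellman
identity follow from this form. -/
lemma sum_law_succ {g₁ : M.Strategy1} {γ : M.VStrategy1} (hγ : IsConditionalPresc g₁ γ)
    {g₂ : M.Strategy2} {t : ℕ} {b : M.Common t → M.Belief t} (hb : IsConsistent g₁ g₂ t b)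
    (φ : M.X (t + 1) → M.Common (t + 1) → ℝ) :
    ∑ h, law g₁ g₂ (t + 1) h * φ (M.state h) (M.common h) =
      ∑ h : M.Hist t, law g₁ g₂ t h * ∑ u₂, ∑ y, g₂ t (M.common h) u₂ *
        M.beliefR t (b (M.common h)) (γ t (M.common h)) u₂ y *
          ∑ x', nextBelief d t (b (M.common h)) (γ t (M.common h)) u₂ y x' *
            φ x' (M.common h, u₂, y) := by
  rw [sum_hist_succ]
  refine (sum_law_step hγ hb fun _ _ u₂ x' y c => φ x' (c, u₂, y)).trans ?_
  refine Finset.sum_congr rfl fun h _ => congrArg _ ?_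
  generalize M.common h = c
  have hQ : ∀ u₂ y x', M.beliefR t (b c) (γ t c) u₂ y *
      nextBelief d t (b c) (γ t c) u₂ y x' = ∑ x, ∑ u₁, b c x * γ t c x u₁ *
        M.transProb t x u₁ u₂ x' y := fun u₂ y x' => (beliefQ_eq_mul d ..).symm
  calc _ = ∑ u₂, ∑ y, ∑ x', g₂ t c u₂ * (∑ x, ∑ u₁, b c x * γ t c x u₁ *
        M.transProb t x u₁ u₂ x' y) * φ x' (c, u₂, y) := by
        simp only [Finset.mul_sum, Finset.sum_mul]
        simp_rw [Finset.sum_comm (s := Finset.univ (α := M.U1 t)),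
          Finset.sum_comm (s := Finset.univ (α := M.X t))]
        refine Finset.sum_congr rfl fun u₂ _ => ?_
        rw [Finset.sum_comm]
        refine Finset.sum_congr rfl fun y _ => Finset.sum_congr rfl fun x' _ =>
          Finset.sum_congr rfl fun x _ => Finset.sum_congr rfl fun u₁ _ => ?_
        ring
    _ = _ := by
        simp only [← hQ, Finset.mul_sum]
        refine Finset.sum_congr rfl fun u₂ _ => Finset.sum_congr rfl fun y _ =>
          Finset.sum_congr rfl fun x' _ => ?_
        ring

/-- Induction along Bayes' rule. The beliefs involve only `γ`, so they are correct simultaneously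
for all `g₂`, even if `g₁` uses the complete history. -/
lemma isConsistent_beliefAlong {g₁ : M.Strategy1} {γ : M.VStrategy1}
    (hγ : IsConditionalPresc g₁ γ) (g₂ : M.Strategy2) :
    ∀ t, IsConsistent g₁ g₂ t (beliefAlong d γ t)
  | 0 => by
    have hinit : ∀ (y : M.Y 0) (x : M.X 0),
        M.initProb x y = (∑ x, M.initProb x y) * initBelief d y x := by
      intro y x
      rcases (Finset.sum_nonneg fun x (_ : x ∈ Finset.univ) =>
        initProb_nonneg (M := M) x y).eq_or_lt with h | h
      · rw [← h, zero_mul]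
        exact (Finset.sum_eq_zero_iff_of_nonneg fun x _ => initProb_nonneg x y).1 h.symm x
          (Finset.mem_univ _)
      · rw [initBelief, dif_pos h]
        exact (mul_div_cancel₀ _ h.ne').symm
    intro φ
    have hsum : ∀ F : M.Hist 0 → ℝ, ∑ h, F h = ∑ y, ∑ x, F (x, y) := fun F =>
      Fintype.sum_prod_type_right (f := fun h : M.X 0 × M.Y 0 => F h)
    rw [hsum, hsum]
    refine Finset.sum_congr rfl fun y _ => ?_
    simp only [law, pathLaw, state, common, beliefAlong]
    rw [← Finset.sum_mul, Finset.mul_sum]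
    refine Finset.sum_congr rfl fun x _ => ?_
    rw [← mul_assoc, ← hinit]
  | t + 1 => by
    intro φ
    have hb := isConsistent_beliefAlong hγ g₂ t
    -- In the second expansion the test function is already averaged over the state, so the updated
    -- belief integrates it with total mass one and both sides agree.
    rw [sum_law_succ d hγ hb,
      sum_law_succ d hγ hb fun _ c => ∑ x, beliefAlong d γ (t + 1) c x * φ x c]
    simp only [beliefAlong, ← Finset.sum_mul, FinDist.sum_eq_one, one_mul]

/-! ### Verification -/

/-- The expected value of the cost incurred before stage `t` plus the value of the belief at
stage `t`. -/
def expectedValue (g₁ : M.Strategy1) (γ : M.VStrategy1) (g₂ : M.Strategy2) (t : ℕ) : ℝ :=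
  ∑ h, law g₁ g₂ t h * (M.totalCost t h + Vu d t (beliefAlong d γ t (M.common h)))

lemma expectedValue_T (g₁ : M.Strategy1) (γ : M.VStrategy1) (g₂ : M.Strategy2) :
    expectedValue d g₁ γ g₂ M.T = M.J g₁ g₂ := by
  refine Finset.sum_congr rfl fun h _ => ?_
  simp [Vu, minmaxValue]

lemma sum_law_totalCost_succ {g₁ : M.Strategy1} {γ : M.VStrategy1} (hγ : IsConditionalPresc g₁ γ)
    {g₂ : M.Strategy2} {t : ℕ} {b : M.Common t → M.Belief t} (hb : IsConsistent g₁ g₂ t b) :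
    ∑ h, law g₁ g₂ (t + 1) h * M.totalCost (t + 1) h =
      ∑ h : M.Hist t, law g₁ g₂ t h * (M.totalCost t h +
        stageCost t (b (M.common h)) (γ t (M.common h)) (g₂ t (M.common h))) := by
  have hcost := sum_law_step hγ hb fun x u₁ u₂ _ _ _ => M.cost t x u₁ u₂
  rw [sum_hist_succ]
  simp only [totalCost, mul_add, Finset.sum_add_distrib]
  congr 1
  · refine Finset.sum_congr rfl fun h _ => ?_
    simp only [law, pathLaw, ← Finset.sum_mul, ← Finset.mul_sum, sum_transProb,
      FinDist.sum_eq_one, mul_one]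
  · refine hcost.trans (Finset.sum_congr rfl fun h _ => congrArg _ ?_)
    simp only [← Finset.sum_mul, ← Finset.mul_sum, sum_transProb, mul_one, stageCost]
    refine Finset.sum_congr rfl fun x _ => Finset.sum_congr rfl fun u₁ _ =>
      Finset.sum_congr rfl fun u₂ _ => ?_
    ring

/-- The Bellman identity: compared with stage `t`, only `Vu` at the belief is replaced by `wu`.
Stagewise inequalities between the two therefore telescope. -/
lemma expectedValue_succ {g₁ : M.Strategy1} {γ : M.VStrategy1} (hγ : IsConditionalPresc g₁ γ)
    (g₂ : M.Strategy2) (t : ℕ) :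
    expectedValue d g₁ γ g₂ (t + 1) = ∑ h, law g₁ g₂ t h * (M.totalCost t h +
      wu d t (beliefAlong d γ t (M.common h)) (γ t (M.common h)) (g₂ t (M.common h))) := by
  have hb := isConsistent_beliefAlong d hγ g₂ t
  simp only [expectedValue, wu, stageObjective]
  simp only [mul_add, Finset.sum_add_distrib]
  rw [sum_law_totalCost_succ hγ hb,
    sum_law_succ d hγ hb fun _ c => Vu d (t + 1) (beliefAlong d γ (t + 1) c)]
  simp only [beliefAlong, ← Finset.sum_mul, FinDist.sum_eq_one, one_mul, mul_add,
    Finset.sum_add_distrib, add_assoc]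

/-- The value of the game. -/
def gameValue : ℝ := ∑ h : M.Hist 0, M.initProb h.1 h.2 * Vu d 0 (initBelief d h.2)

lemma expectedValue_zero (g₁ : M.Strategy1) (γ : M.VStrategy1) (g₂ : M.Strategy2) :
    expectedValue d g₁ γ g₂ 0 = gameValue d := by
  refine Finset.sum_congr rfl fun h _ => ?_
  simp only [law, pathLaw, totalCost, zero_add]
  rfl

lemma J_le_gameValue {g₁ : M.Strategy1} {γ : M.VStrategy1} (hγ : IsConditionalPresc g₁ γ)
    (g₂ : M.Strategy2)
    (h : ∀ t < M.T, ∀ c, wu d t (beliefAlong d γ t c) (γ t c) (g₂ t c) ≤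
      Vu d t (beliefAlong d γ t c)) : M.J g₁ g₂ ≤ gameValue d := by
  have key : ∀ t ≤ M.T, expectedValue d g₁ γ g₂ t ≤ gameValue d := by
    intro t
    induction t with
    | zero => exact fun _ => (expectedValue_zero d g₁ γ g₂).le
    | succ t ih =>
      intro ht
      refine le_trans ?_ (ih (by omega))
      rw [expectedValue_succ d hγ]
      exact Finset.sum_le_sum fun k _ => mul_le_mul_of_nonneg_left
        (add_le_add_right (h t ht _) _) (law_nonneg ..)
  exact (expectedValue_T d g₁ γ g₂).symm.trans_le (key M.T le_rfl)

lemma gameValue_le_J {g₁ : M.Strategy1} {γ : M.VStrategy1} (hγ : IsConditionalPresc g₁ γ)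
    (g₂ : M.Strategy2)
    (h : ∀ t < M.T, ∀ c, Vu d t (beliefAlong d γ t c) ≤
      wu d t (beliefAlong d γ t c) (γ t c) (g₂ t c)) : gameValue d ≤ M.J g₁ g₂ := by
  have key : ∀ t ≤ M.T, gameValue d ≤ expectedValue d g₁ γ g₂ t := by
    intro t
    induction t with
    | zero => exact fun _ => (expectedValue_zero d g₁ γ g₂).ge
    | succ t ih =>
      intro ht
      refine (ih (by omega)).trans ?_
      rw [expectedValue_succ d hγ]
      exact Finset.sum_le_sum fun k _ => mul_le_mul_of_nonneg_left
        (add_le_add_right (h t ht _) _) (law_nonneg ..)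
  exact (key M.T le_rfl).trans_eq (expectedValue_T d g₁ γ g₂)

/-- Once `g₁` is fixed, `γ` and the beliefs are functions of the common information, so maximizing
`wu` stage by stage is a legitimate strategy of player 2. -/
lemma exists_gameValue_le_J (g₁ : M.Strategy1) : ∃ g₂, gameValue d ≤ M.J g₁ g₂ := by
  obtain ⟨γ, hγ⟩ := exists_isConditionalPresc g₁
  choose g₂ hg₂ using fun t c => exists_Vu_le_wu d (beliefAlong d γ t c) (γ t c)
  exact ⟨g₂, gameValue_le_J d hγ g₂ fun t ht c => hg₂ t c ht⟩

/-- Player 2 can guarantee the value although he does not know the strategy of player 1. -/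
lemma exists_forall_gameValue_le_J : ∃ g₂, ∀ g₁ : M.Strategy1, gameValue d ≤ M.J g₁ g₂ := by
  obtain ⟨a, b, hab⟩ := exists_saddle_J (M := M)
  obtain ⟨g₂, hg₂⟩ := exists_gameValue_le_J d a
  exact ⟨b, fun g₁ => hg₂.trans (hab g₁ g₂)⟩

/-! ### The conditional law of the state given the common information -/

open Classical in
lemma stateCommonProb_eq_sum (g₁ : M.Strategy1) (g₂ : M.Strategy2) (t : ℕ) (x : M.X t)
    (c : M.Common t) : stateCommonProb g₁ g₂ t x c = ∑ h : M.Hist t,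
      law g₁ g₂ t h * if M.state h = x ∧ M.common h = c then 1 else 0 :=
  Finset.sum_congr rfl fun h _ => by split_ifs <;> simp

open Classical in
lemma IsConsistent.stateCommonProb_eq {g₁ : M.Strategy1} {g₂ : M.Strategy2} {t : ℕ}
    {b : M.Common t → M.Belief t} (hb : IsConsistent g₁ g₂ t b) (x : M.X t) (c : M.Common t) :
    stateCommonProb g₁ g₂ t x c = commonProb g₁ g₂ t c * b c x := by
  have h : ∀ x, stateCommonProb g₁ g₂ t x c =
      (∑ h : M.Hist t, law g₁ g₂ t h * if M.common h = c then 1 else 0) * b c x := by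
    intro x
    -- Consistency is tested on the indicator of `(x, c)`.
    rw [stateCommonProb_eq_sum, hb fun x' c' => if x' = x ∧ c' = c then 1 else 0, Finset.sum_mul]
    refine Finset.sum_congr rfl fun h _ => ?_
    by_cases hc : M.common h = c
    · simp [hc]
    · simp [hc]
  simp only [commonProb, h]
  rw [← Finset.mul_sum, FinDist.sum_eq_one, mul_one]

lemma isBeliefBased {ψ : ∀ t, M.Belief t → M.Presc1 t} {γ : M.VStrategy1} {g : M.ReducedStrategy1}
    (hg : ∀ t x c, g t x c = γ t c x) (hψ : ∀ t c, γ t c = ψ t (beliefAlong d γ t c)) :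
    IsBeliefBased ψ g := by
  intro g₂ t _ c hc
  have hb := isConsistent_beliefAlong d
    (isConditionalPresc_of_eq (g₁ := g.toStrategy1) fun t k => hg t _ _) g₂ t
  refine ⟨beliefAlong d γ t c, fun x => ?_, fun x => by rw [hg, ← hψ]⟩
  rw [hb.stateCommonProb_eq x c, mul_div_cancel_left₀ _ hc.ne']

end GameModel

theorem theorem3 (M : GameModel.{u}) (d : M.DefaultBeliefs) :
    -- both dynamic programs have solutions
    (∃ ψ : ∀ t, M.Belief t → M.Presc1 t, GameModel.IsMinmaxSolution d ψ) ∧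
    (∃ φ : ∀ t, M.Belief t → M.Presc2 t, GameModel.IsMaxminSolution d φ) ∧
    -- and every pair of solutions has the following properties
    ∀ (ψ : ∀ t, M.Belief t → M.Presc1 t) (φ : ∀ t, M.Belief t → M.Presc2 t),
      GameModel.IsMinmaxSolution d ψ → GameModel.IsMaxminSolution d φ →
      ∀ (χ : M.VStrategy1) (g : M.ReducedStrategy1),
        χ = M.rho1 (GameModel.beliefEStrategy1 d ψ) (GameModel.beliefEStrategy2 d φ) →
        (∀ t x c, g t x c = χ t c x) →
        -- in the virtual game
        (IsMinimaxStrategy M.virtualJ χ ∧ IsEquilibriumStrategy M.virtualJ χ) ∧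
        -- in the game in which player 1 knows the current state and the common information
        (IsMinimaxStrategy M.reducedJ g ∧ IsEquilibriumStrategy M.reducedJ g) ∧
        -- in the original game
        (IsMinimaxStrategy M.J g.toStrategy1 ∧ IsEquilibriumStrategy M.J g.toStrategy1) ∧
        -- and the strategy is based on the common information belief
        GameModel.IsBeliefBased ψ g := by
  refine ⟨GameModel.exists_isMinmaxSolution d, GameModel.exists_isMaxminSolution d,
    fun ψ φ hψ _ χ g hχ hg => ?_⟩
  -- A closed recursion for `χ`: it applies `ψ` to the beliefs that it generates itself.
  have hχψ : ∀ t c, χ t c = ψ t (GameModel.beliefAlong d χ t c) := by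
    subst hχ
    intro t c
    rw [← GameModel.belief_realizedPresc]
    rfl
  have hle : ∀ g₂, M.J g.toStrategy1 g₂ ≤ GameModel.gameValue d := by
    refine fun g₂ => GameModel.J_le_gameValue d
      (GameModel.isConditionalPresc_of_eq (γ := χ) fun t k => hg t _ _) g₂ fun t ht c => ?_
    rw [hχψ]
    exact (hψ t ht _).2 ⟨g₂ t c, rfl⟩
  obtain ⟨g₂, hge⟩ := GameModel.exists_forall_gameValue_le_J d
  -- A virtual profile is a profile of the original game in which player 1 uses only the state and
  -- the common information, so both bounds restrict to it.
  have hv : ∀ χ' : M.VStrategy1,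
      M.virtualJ χ' = M.J fun t h => χ' t (M.common h) (M.state h) := fun _ => rfl
  have hgχ : (fun t h => χ t (M.common h) (M.state h) : M.Strategy1) = g.toStrategy1 :=
    funext fun t => funext fun h => (hg t _ _).symm
  refine ⟨isMinimaxStrategy_and_isEquilibriumStrategy (b := g₂) (v := GameModel.gameValue d)
      (fun χ' => ?_) (fun b' => ?_) fun χ' => ?_,
    isMinimaxStrategy_and_isEquilibriumStrategy (b := g₂) (v := GameModel.gameValue d)
      (fun g' => GameModel.bddAbove_range_J g'.toStrategy1) hle fun g' => hge g'.toStrategy1,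
    isMinimaxStrategy_and_isEquilibriumStrategy (b := g₂) (v := GameModel.gameValue d)
      GameModel.bddAbove_range_J hle hge,
    GameModel.isBeliefBased d hg hχψ⟩
  · rw [hv]
    exact GameModel.bddAbove_range_J _
  · rw [hv, hgχ]
    exact hle b'
  · rw [hv]
    exact hge _

end
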